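/- **Theorem (SAT-based generalized satisfiability checking).** Let $AP$ be a set of atoms and let $\varphi$ be an LTL formula over $AP$ in negation normal form, built from $\mathsf{tt}$, $\mathsf{ff}$ and literals $a,\neg a$ ($a\in AP$) with $\wedge,\vee,X,U,R$. It is *satisfiable* if $\xi\models\varphi$ for some infinite sequence $\xi$ of consistent sets of literals. *Tagging.* Let $\varphi_t$ be the formula obtained from $\varphi$ by replacing every occurrence of an atom by a copy of that atom, different occurrences receiving different copies. Copies of the same atom are syntactically different but semantically equivalent; in particular a set of literals that contains $a_i$ and $\neg a_j$, with $a_i,a_j$ copies of the same atom $a$, is inconsistent. *Transition system.* Conjunctions are identified up to associativity, commutativity, idempotence and the unit $\mathsf{tt}$. The normal form $NF(\psi)$ is the set of formulas $\alpha\wedge X\psi'$, with $\alpha$ a conjunction of literals, given by $NF(\mathsf{tt})=\{\mathsf{tt}\wedge X\mathsf{tt}\}$, $NF(\mathsf{ff})=\emptyset$, $NF(l)=\{l\wedge X\mathsf{tt}\}$ for a literal $l$, $NF(X\psi)=\{\mathsf{tt}\wedge X\psi'\mid \psi' \text{ a disjunct of }\psi\}$, $NF(\psi_1\vee\psi_2)=NF(\psi_1)\cup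 NF(\psi_2)$, $NF(\psi_1\wedge\psi_2)=\{(\alpha_1\wedge\alpha_2)\wedge X(\psi_1'\wedge\psi_2')\mid \alpha_i\wedge X\psi_i'\in NF(\psi_i)\}$, $NF(\psi_1U\psi_2)=NF(\psi_2)\cup NF(\psi_1\wedge X(\psi_1U\psi_2))$ and $NF(\psi_1R\psi_2)=NF(\psi_1\wedge\psi_2)\cup NF(\psi_2\wedge X(\psi_1R\psi_2))$. The transition system $T_{\varphi_t}$ has initial state $\varphi_t$ and a transition $\psi\xrightarrow{\alpha}\psi'$ whenever $\alpha\wedge X\psi'\in NF(\psi)$ and $\alpha$ is consistent; its states are those reachable from $\varphi_t$. For a strongly connected component $scc$ of $T_{\varphi_t}$ (a class of mutually reachable states), $L(scc)$ is the set of literals occurring in labels of transitions between states of $scc$. *Obligation formula and weak satisfaction.* The Boolean formula $of(\psi)$ is defined by $of(\mathsf{tt})=\mathsf{tt}$, $of(\mathsf{ff})=\mathsf{ff}$, $of(l)=l$ for a literal $l$, $of(X\psi)=of(\psi)$, $of(\psi_1U\psi_2)=of(\psi_1R\psi_2)=of(\psi_2)$, $of(\psi_1\wedge\psi_2)=of(\psi_1)\wedge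 of(\psi_2)$ and $of(\psi_1\vee\psi_2)=of(\psi_1)\vee of(\psi_2)$. For a (not necessarily consistent) set $S$ of literals, $S\models_w\mathsf{tt}$ always, $S\models_w\mathsf{ff}$ never, $S\models_w l$ iff $l\in S$ for a literal $l$, and $\models_w$ commutes with $\wedge$ and $\vee$. Then $\varphi$ is satisfiable if and only if there are a strongly connected component $scc$ of $T_{\varphi_t}$ and a state $\psi\in scc$ such that $L(scc)\models_w of(\psi)$. -/

import Mathlib

/-- A literal over the set `A` of atoms: an atom or the negation of an atom. -/
inductive Literal (A : Type*) where
  | pos (a : A) : Literal A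
  | neg (a : A) : Literal A

namespace Literal

/-- The literal obtained by renaming the atom. -/
def map {A B : Type*} (g : A → B) : Literal A → Literal B
  | pos a => pos (g a)
  | neg a => neg (g a)

/-- A set of literals is consistent if it does not contain an atom together with its negation. -/
def Consistent {A : Type*} (S : Set (Literal A)) : Prop :=
  ∀ a : A, ¬ (pos a ∈ S ∧ neg a ∈ S)

end Literal

/-- LTL formulas in negation normal form over the set `A` of atoms. -/
inductive LTL (A : Type*) where
  | tt : LTL A
  | ff : LTL A
  | lit (l : Literal A) : LTL A
  | and (φ ψ : LTL A) : LTL A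
  | or (φ ψ : LTL A) : LTL A
  | next (φ : LTL A) : LTL A
  | untl (φ ψ : LTL A) : LTL A
  | release (φ ψ : LTL A) : LTL A

/-- Boolean formulas in negation normal form over the set `A` of atoms. -/
inductive BoolFormula (A : Type*) where
  | tt : BoolFormula A
  | ff : BoolFormula A
  | lit (l : Literal A) : BoolFormula A
  | and (α β : BoolFormula A) : BoolFormula A
  | or (α β : BoolFormula A) : BoolFormula A

/-- Syntactic weak satisfaction `S ⊨_w α`; the set `S` need not be consistent. -/
def BoolFormula.WeakSat {A : Type*} (S : Set (Literal A)) : BoolFormula A → Prop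
  | tt => True
  | ff => False
  | lit l => l ∈ S
  | and α β => WeakSat S α ∧ WeakSat S β
  | or α β => WeakSat S α ∨ WeakSat S β

namespace LTL

/-- Satisfaction of a formula by an infinite sequence of literal sets; `fun n => ξ (i + n)` is the
suffix of `ξ` from position `i`. -/
def Sat {A : Type*} : (ℕ → Set (Literal A)) → LTL A → Prop
  | _, tt => True
  | _, ff => False
  | ξ, lit l => l ∈ ξ 0
  | ξ, and φ ψ => Sat ξ φ ∧ Sat ξ ψ
  | ξ, or φ ψ => Sat ξ φ ∨ Sat ξ ψ
  | ξ, next φ => Sat (fun n => ξ (1 + n)) φ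
  | ξ, untl φ ψ =>
      ∃ i, Sat (fun n => ξ (i + n)) ψ ∧ ∀ j < i, Sat (fun n => ξ (j + n)) φ
  | ξ, release φ ψ =>
      (∀ i, Sat (fun n => ξ (i + n)) ψ) ∨
      ∃ i, (Sat (fun n => ξ (i + n)) φ ∧ Sat (fun n => ξ (i + n)) ψ) ∧
        ∀ j < i, Sat (fun n => ξ (j + n)) ψ

/-- A formula is satisfiable if some trace of consistent literal sets satisfies it. -/
def Satisfiable {A : Type*} (φ : LTL A) : Prop :=
  ∃ ξ : ℕ → Set (Literal A), (∀ i, Literal.Consistent (ξ i)) ∧ Sat ξ φ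

/-- The obligation formula. -/
def obligation {A : Type*} : LTL A → BoolFormula A
  | tt => .tt
  | ff => .ff
  | lit l => .lit l
  | and φ ψ => .and (obligation φ) (obligation ψ)
  | or φ ψ => .or (obligation φ) (obligation ψ)
  | next φ => obligation φ
  | untl _ ψ => obligation ψ
  | release _ ψ => obligation ψ

/-- The set of conjuncts of a formula, i.e. the formula read as a conjunction up to associativity,
commutativity, idempotence and the unit `tt` of `∧`. -/
def conjuncts {A : Type*} : LTL A → Set (LTL A)
  | tt => ∅
  | and φ ψ => conjuncts φ ∪ conjuncts ψ
  | φ => {φ}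

/-- The set of disjuncts of a formula. -/
def disjuncts {A : Type*} : LTL A → Set (LTL A)
  | or φ ψ => disjuncts φ ∪ disjuncts ψ
  | φ => {φ}

/-- The normal form of a formula. A pair `(α, Ψ)` stands for `⋀ α ∧ X (⋀ Ψ)`, where `α` is a set of
literals and `Ψ` a set of formulas. The clauses for `untl` and `release` are those of
`φ₂ ∨ (φ₁ ∧ X (φ₁ U φ₂))` and `(φ₁ ∧ φ₂) ∨ (φ₂ ∧ X (φ₁ R φ₂))`. -/
def normalForm {A : Type*} : LTL A → Set (Set (Literal A) × Set (LTL A))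
  | tt => {(∅, ∅)}
  | ff => ∅
  | lit l => {({l}, ∅)}
  | next φ => {p | ∃ ψ ∈ disjuncts φ, p = (∅, conjuncts ψ)}
  | untl φ₁ φ₂ =>
      normalForm φ₂ ∪ {p | ∃ q ∈ normalForm φ₁, p = (q.1, q.2 ∪ {untl φ₁ φ₂})}
  | release φ₁ φ₂ =>
      {p | ∃ q ∈ normalForm φ₁, ∃ r ∈ normalForm φ₂, p = (q.1 ∪ r.1, q.2 ∪ r.2)} ∪
      {p | ∃ q ∈ normalForm φ₂, p = (q.1, q.2 ∪ {release φ₁ φ₂})}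
  | or φ₁ φ₂ => normalForm φ₁ ∪ normalForm φ₂
  | and φ₁ φ₂ =>
      {p | ∃ q ∈ normalForm φ₁, ∃ r ∈ normalForm φ₂, p = (q.1 ∪ r.1, q.2 ∪ r.2)}

/-- The normal form of the conjunction of the formulas in `Ψ`: one element of the normal form of
each conjunct is chosen, and the chosen elements are conjoined. -/
def conjNormalForm {A : Type*} (Ψ : Set (LTL A)) : Set (Set (Literal A) × Set (LTL A)) :=
  {p | ∃ f : LTL A → Set (Literal A) × Set (LTL A),
    (∀ ψ ∈ Ψ, f ψ ∈ normalForm ψ) ∧ p = (⋃ ψ ∈ Ψ, (f ψ).1, ⋃ ψ ∈ Ψ, (f ψ).2)}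

/-- Every occurrence of an atom is replaced by a copy of its own: the copy of the atom `a` at the
occurrence with address `p` in the syntax tree is `(a, p)`. -/
def tagFrom {A : Type*} (p : List Bool) : LTL A → LTL (A × List Bool)
  | tt => tt
  | ff => ff
  | lit l => lit (l.map fun a => (a, p))
  | next φ => next (tagFrom p φ)
  | and φ ψ => and (tagFrom (false :: p) φ) (tagFrom (true :: p) ψ)
  | or φ ψ => or (tagFrom (false :: p) φ) (tagFrom (true :: p) ψ)
  | untl φ ψ => untl (tagFrom (false :: p) φ) (tagFrom (true :: p) ψ)
  | release φ ψ => release (tagFrom (false :: p) φ) (tagFrom (true :: p) ψ)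

/-- The tagged formula, in which the copies of an atom at different occurrences are distinct. -/
def tag {A : Type*} (φ : LTL A) : LTL (A × List Bool) := tagFrom [] φ

end LTL

/-- A labelled transition system whose labels are sets of literals, read conjunctively. -/
structure TransitionSystem (A S : Type*) where
  /-- the initial state -/
  init : S
  /-- the labelled transitions -/
  Tran : S → Set (Literal A) → S → Prop

namespace TransitionSystem

variable {A S : Type*} (T : TransitionSystem A S)

/-- There is a finite path, possibly of length zero, from the first state to the second one. -/
def Path : S → S → Prop :=
  Relation.ReflTransGen fun s t => ∃ α, T.Tran s α t

/-- `scc` is a strongly connected component of the part of the system reachable from the initial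
state: the class of some reachable state under mutual reachability. -/
def IsSCC (scc : Set S) : Prop :=
  ∃ s, T.Path T.init s ∧ scc = {t | T.Path s t ∧ T.Path t s}

/-- `L(scc)`: the literals on the transitions inside `scc`. -/
def sccLiterals (scc : Set S) : Set (Literal A) :=
  {l | ∃ s ∈ scc, ∃ t ∈ scc, ∃ α, T.Tran s α t ∧ l ∈ α}

end TransitionSystem

/-- The LTL transition system of `φ`. Atoms carry copies, which are syntactically different but
semantically the same atom. The states are conjunctions, given as sets of formulas, and labels that
are unsatisfiable (once copies of an atom are identified) are excluded. -/
def ltlTransitionSystem {A I : Type*} (φ : LTL (A × I)) :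
    TransitionSystem (A × I) (Set (LTL (A × I))) where
  init := φ.conjuncts
  Tran Ψ α Ψ' :=
    (α, Ψ') ∈ LTL.conjNormalForm Ψ ∧ Literal.Consistent (Literal.map Prod.fst '' α)

/-! From left to right, a model of the tagged formula guides a run: every formula of a state takes
an element of its normal form that is true along the model, and an until is fulfilled as soon as its
right side holds (`pick`). States are sets of subformulas, hence finite in number, so the run ends
in one component. There every true formula finds the literals of its obligation in the labels still
to come (`weakSat_obligation_of_pick`).

From right to left, a closed walk through the given state that uses every literal of `L(scc)` is
repeated forever (`exists_run`). Its labels form a trace, which is extended backwards to the initial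
state (`exists_sat_of_path`). The only danger is an until that is postponed forever. It then lies in
all late states, so `L(scc)` weakly satisfies the obligation of its right side `ψ`. If `ψ` is taken
up anew infinitely often, it holds infinitely often by induction. Otherwise tagging decides: each
literal of `ψ` has a single occurrence, so it can recur in the labels only because a subformula of
`ψ` above it stays in all late states, and such a subformula is true there. Following the obligation
down from `ψ`, these true subformulas make `ψ` eventually true, so the until is fulfilled
(`sat_of_realised_aux`). Without tagging, the literals could stem from an unrelated occurrence. -/

namespace Literal

/-- The atom of a literal. -/
def atom {A : Type*} : Literal A → A
  | pos a => a
  | neg a => a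

theorem atom_map {A B : Type*} (g : A → B) (l : Literal A) : (l.map g).atom = g l.atom := by
  cases l <;> rfl

theorem map_fst_map {A I : Type*} (i : I) (l : Literal A) :
    (l.map fun a => (a, i)).map Prod.fst = l := by
  cases l <;> rfl

theorem Consistent.subset {A : Type*} {S T : Set (Literal A)} (hT : Consistent T) (h : S ⊆ T) :
    Consistent S := fun a ha => hT a ⟨h ha.1, h ha.2⟩

end Literal

namespace LTL

open Filter

/-! ### Unfolding laws and soundness of the normal form -/

section Basic

variable {A : Type*}

/-- The suffix of a sequence from position `i`. -/
def suffix {X : Type*} (ξ : ℕ → X) (i : ℕ) : ℕ → X := fun n => ξ (i + n)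

theorem suffix_zero {X : Type*} (ξ : ℕ → X) : suffix ξ 0 = ξ := by
  funext n; simp [suffix]

theorem suffix_suffix {X : Type*} (ξ : ℕ → X) (i j : ℕ) :
    suffix (suffix ξ i) j = suffix ξ (i + j) := by
  funext n; simp [suffix, Nat.add_assoc]

theorem sat_next {ξ : ℕ → Set (Literal A)} {φ : LTL A} :
    Sat ξ (next φ) ↔ Sat (suffix ξ 1) φ := Iff.rfl

theorem sat_untl {ξ : ℕ → Set (Literal A)} {φ ψ : LTL A} :
    Sat ξ (untl φ ψ) ↔ ∃ i, Sat (suffix ξ i) ψ ∧ ∀ j < i, Sat (suffix ξ j) φ := Iff.rfl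

theorem sat_release {ξ : ℕ → Set (Literal A)} {φ ψ : LTL A} :
    Sat ξ (release φ ψ) ↔ (∀ i, Sat (suffix ξ i) ψ) ∨
      ∃ i, (Sat (suffix ξ i) φ ∧ Sat (suffix ξ i) ψ) ∧ ∀ j < i, Sat (suffix ξ j) ψ := Iff.rfl

theorem sat_untl_unfold {ξ : ℕ → Set (Literal A)} {φ ψ : LTL A} :
    Sat ξ (untl φ ψ) ↔ Sat ξ ψ ∨ Sat ξ φ ∧ Sat (suffix ξ 1) (untl φ ψ) := by
  simp only [sat_untl, suffix_suffix]
  constructor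
  · rintro ⟨_ | i, h, h'⟩
    · left; rwa [suffix_zero] at h
    · right
      refine ⟨by simpa [suffix_zero] using h' 0 (by omega), i, by rwa [Nat.add_comm], ?_⟩
      intro j hj
      rw [Nat.add_comm]
      exact h' _ (by omega)
  · rintro (h | ⟨h, i, hi, h'⟩)
    · exact ⟨0, by rwa [suffix_zero], by simp⟩
    · refine ⟨1 + i, hi, ?_⟩
      rintro (_ | j) hj
      · rwa [suffix_zero]
      · rw [Nat.add_comm]
        exact h' _ (by omega)

theorem sat_release_unfold {ξ : ℕ → Set (Literal A)} {φ ψ : LTL A} :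
    Sat ξ (release φ ψ) ↔
      Sat ξ ψ ∧ (Sat ξ φ ∨ Sat (suffix ξ 1) (release φ ψ)) := by
  simp only [sat_release, suffix_suffix]
  constructor
  · rintro (h | ⟨_ | i, h, h'⟩)
    · exact ⟨by simpa [suffix_zero] using h 0, .inr (.inl fun i => h _)⟩
    · rw [suffix_zero] at h
      exact ⟨h.2, .inl h.1⟩
    · refine ⟨by simpa [suffix_zero] using h' 0 (by omega), .inr (.inr ⟨i, ?_, ?_⟩)⟩
      · rwa [Nat.add_comm]
      · intro j hj
        rw [Nat.add_comm]
        exact h' _ (by omega)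
  · rintro ⟨h, h' | h' | ⟨i, hi, h'⟩⟩
    · exact .inr ⟨0, by rw [suffix_zero]; exact ⟨h', h⟩, by simp⟩
    · left
      rintro (_ | i)
      · rwa [suffix_zero]
      · rw [Nat.add_comm]; exact h' i
    · refine .inr ⟨1 + i, hi, ?_⟩
      rintro (_ | j) hj
      · rwa [suffix_zero]
      · rw [Nat.add_comm]
        exact h' _ (by omega)

theorem sat_of_conjuncts {ξ : ℕ → Set (Literal A)} {φ : LTL A}
    (h : ∀ ψ ∈ conjuncts φ, Sat ξ ψ) : Sat ξ φ := by
  induction φ with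
  | tt => trivial
  | and φ ψ ihφ ihψ => exact ⟨ihφ fun χ hχ => h χ (.inl hχ), ihψ fun χ hχ => h χ (.inr hχ)⟩
  | _ => exact h _ rfl

theorem sat_conjuncts {ξ : ℕ → Set (Literal A)} {φ : LTL A} (h : Sat ξ φ) :
    ∀ ψ ∈ conjuncts φ, Sat ξ ψ := by
  induction φ with
  | tt => rintro ψ ⟨⟩
  | and φ ψ ihφ ihψ =>
    rintro χ (hχ | hχ)
    exacts [ihφ h.1 χ hχ, ihψ h.2 χ hχ]
  | _ => rintro ψ rfl; exact h

theorem sat_of_disjunct {ξ : ℕ → Set (Literal A)} {φ ψ : LTL A} (hψ : ψ ∈ disjuncts φ)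
    (h : Sat ξ ψ) : Sat ξ φ := by
  induction φ with
  | or φ₁ φ₂ ih₁ ih₂ => exact hψ.imp ih₁ ih₂
  | _ => obtain rfl := hψ; exact h

/-- The normal form is sound. -/
theorem sat_of_mem_normalForm {ξ : ℕ → Set (Literal A)} {φ : LTL A}
    {q : Set (Literal A) × Set (LTL A)} (hq : q ∈ normalForm φ) (h₁ : q.1 ⊆ ξ 0)
    (h₂ : ∀ θ ∈ q.2, Sat (suffix ξ 1) θ) : Sat ξ φ := by
  induction φ generalizing q with
  | tt => trivial
  | ff => exact hq
  | lit l => obtain rfl := hq; exact h₁ rfl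
  | next φ ih =>
    obtain ⟨ψ, hψ, rfl⟩ := hq
    exact sat_of_disjunct (ξ := suffix ξ 1) hψ (sat_of_conjuncts h₂)
  | or φ ψ ihφ ihψ => exact hq.imp (fun hq => ihφ hq h₁ h₂) (fun hq => ihψ hq h₁ h₂)
  | and φ ψ ihφ ihψ =>
    obtain ⟨r, hr, s, hs, rfl⟩ := hq
    exact ⟨ihφ hr (fun l hl => h₁ (.inl hl)) (fun θ hθ => h₂ θ (.inl hθ)),
      ihψ hs (fun l hl => h₁ (.inr hl)) (fun θ hθ => h₂ θ (.inr hθ))⟩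
  | untl φ ψ ihφ ihψ =>
    rw [sat_untl_unfold]
    obtain hq | ⟨r, hr, rfl⟩ := hq
    · exact .inl (ihψ hq h₁ h₂)
    · exact .inr ⟨ihφ hr h₁ fun θ hθ => h₂ θ (.inl hθ), h₂ _ (.inr rfl)⟩
  | release φ ψ ihφ ihψ =>
    rw [sat_release_unfold]
    obtain ⟨r, hr, s, hs, rfl⟩ | ⟨r, hr, rfl⟩ := hq
    · exact ⟨ihψ hs (fun l hl => h₁ (.inr hl)) (fun θ hθ => h₂ θ (.inr hθ)),
        .inl (ihφ hr (fun l hl => h₁ (.inl hl)) (fun θ hθ => h₂ θ (.inl hθ)))⟩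
    · exact ⟨ihψ hr h₁ fun θ hθ => h₂ θ (.inl hθ), .inr (h₂ _ (.inr rfl))⟩

/-! ### Subformulas, literals and uniqueness of parents -/

/-- The subformulas of a formula. -/
def subformulas : LTL A → Set (LTL A)
  | tt => {tt}
  | ff => {ff}
  | lit l => {lit l}
  | and φ ψ => {and φ ψ} ∪ (subformulas φ ∪ subformulas ψ)
  | or φ ψ => {or φ ψ} ∪ (subformulas φ ∪ subformulas ψ)
  | next φ => {next φ} ∪ subformulas φ
  | untl φ ψ => {untl φ ψ} ∪ (subformulas φ ∪ subformulas ψ)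
  | release φ ψ => {release φ ψ} ∪ (subformulas φ ∪ subformulas ψ)

/-- The literals occurring in a formula. -/
def literals : LTL A → Set (Literal A)
  | tt => ∅
  | ff => ∅
  | lit l => {l}
  | and φ ψ => literals φ ∪ literals ψ
  | or φ ψ => literals φ ∪ literals ψ
  | next φ => literals φ
  | untl φ ψ => literals φ ∪ literals ψ
  | release φ ψ => literals φ ∪ literals ψ

/-- The immediate subformulas of a formula. -/
def children : LTL A → Set (LTL A)
  | tt => ∅
  | ff => ∅
  | lit _ => ∅
  | and φ ψ => {φ, ψ}
  | or φ ψ => {φ, ψ}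
  | next φ => {φ}
  | untl φ ψ => {φ, ψ}
  | release φ ψ => {φ, ψ}

/-- A formula in which no literal occurs twice. -/
def Linear : LTL A → Prop
  | tt => True
  | ff => True
  | lit _ => True
  | and φ ψ => Linear φ ∧ Linear ψ ∧ Disjoint (literals φ) (literals ψ)
  | or φ ψ => Linear φ ∧ Linear ψ ∧ Disjoint (literals φ) (literals ψ)
  | next φ => Linear φ
  | untl φ ψ => Linear φ ∧ Linear ψ ∧ Disjoint (literals φ) (literals ψ)
  | release φ ψ => Linear φ ∧ Linear ψ ∧ Disjoint (literals φ) (literals ψ)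

theorem self_mem_subformulas (φ : LTL A) : φ ∈ subformulas φ := by
  cases φ <;> simp [subformulas]

theorem finite_subformulas (φ : LTL A) : (subformulas φ).Finite := by
  induction φ <;> simp_all [subformulas]

theorem finite_literals (φ : LTL A) : (literals φ).Finite := by
  induction φ <;> simp_all [literals]

theorem subformulas_trans {φ ψ χ : LTL A} (h₁ : χ ∈ subformulas ψ) (h₂ : ψ ∈ subformulas φ) :
    χ ∈ subformulas φ := by
  induction φ with
  | tt | ff | lit => obtain rfl := h₂; exact h₁
  | next φ ih =>
    obtain rfl | h₂ := h₂
    exacts [h₁, .inr (ih h₂)]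
  | and φ₁ φ₂ ih₁ ih₂ | or φ₁ φ₂ ih₁ ih₂ | untl φ₁ φ₂ ih₁ ih₂ | release φ₁ φ₂ ih₁ ih₂ =>
    obtain rfl | h₂ | h₂ := h₂
    exacts [h₁, .inr (.inl (ih₁ h₂)), .inr (.inr (ih₂ h₂))]

theorem subformulas_of_children {φ ψ : LTL A} (h : ψ ∈ children φ) : ψ ∈ subformulas φ := by
  cases φ <;> simp only [children, Set.mem_insert_iff, Set.mem_singleton_iff,
    Set.mem_empty_iff_false] at h
  case next => subst h; exact .inr (self_mem_subformulas _)
  all_goals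
    obtain rfl | rfl := h
    exacts [.inr (.inl (self_mem_subformulas _)), .inr (.inr (self_mem_subformulas _))]

theorem literals_subset_of_subformulas {φ ψ : LTL A} (h : ψ ∈ subformulas φ) :
    literals ψ ⊆ literals φ := by
  induction φ with
  | tt | ff | lit => obtain rfl := h; rfl
  | next φ ih =>
    obtain rfl | h := h
    exacts [subset_rfl, ih h]
  | and φ₁ φ₂ ih₁ ih₂ | or φ₁ φ₂ ih₁ ih₂ | untl φ₁ φ₂ ih₁ ih₂ | release φ₁ φ₂ ih₁ ih₂ =>
    obtain rfl | h | h := h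
    exacts [subset_rfl, (ih₁ h).trans Set.subset_union_left, (ih₂ h).trans Set.subset_union_right]

theorem sizeOf_le_of_subformulas {φ ψ : LTL A} (h : ψ ∈ subformulas φ) : sizeOf ψ ≤ sizeOf φ := by
  induction φ with
  | tt | ff | lit => obtain rfl := h; rfl
  | next φ ih =>
    obtain rfl | h := h
    · rfl
    · have := ih h
      simp only [next.sizeOf_spec]; omega
  | and φ₁ φ₂ ih₁ ih₂ | or φ₁ φ₂ ih₁ ih₂ | untl φ₁ φ₂ ih₁ ih₂ | release φ₁ φ₂ ih₁ ih₂ =>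
    obtain rfl | h | h := h
    · rfl
    · have := ih₁ h
      simp only [and.sizeOf_spec, or.sizeOf_spec, untl.sizeOf_spec, release.sizeOf_spec]; omega
    · have := ih₂ h
      simp only [and.sizeOf_spec, or.sizeOf_spec, untl.sizeOf_spec, release.sizeOf_spec]; omega

theorem sizeOf_lt_of_children {φ ψ : LTL A} (h : ψ ∈ children φ) : sizeOf ψ < sizeOf φ := by
  cases φ <;> simp only [children, Set.mem_insert_iff, Set.mem_singleton_iff,
    Set.mem_empty_iff_false] at h
  case next => subst h; simp
  all_goals
    obtain rfl | rfl := h <;>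
    simp only [and.sizeOf_spec, or.sizeOf_spec, untl.sizeOf_spec, release.sizeOf_spec] <;> omega

/-- A formula whose subformula has a given child contains the literals of that child. -/
theorem literals_subset_of_children {φ χ ψ : LTL A} (hχ : χ ∈ subformulas φ)
    (h : ψ ∈ children χ) : literals ψ ⊆ literals φ :=
  literals_subset_of_subformulas (subformulas_trans (subformulas_of_children h) hχ)

/-- The inductive step of `parent_unique` for formulas with two immediate subformulas. -/
theorem parent_unique_binary {φ φ₁ φ₂ χ₁ χ₂ ψ : LTL A} (hφ : children φ = {φ₁, φ₂})
    (hd : Disjoint (literals φ₁) (literals φ₂)) (hψ : (literals ψ).Nonempty)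
    (h₁ : ψ ∈ children χ₁) (h₂ : ψ ∈ children χ₂)
    (ih₁ : χ₁ ∈ subformulas φ₁ → χ₂ ∈ subformulas φ₁ → χ₁ = χ₂)
    (ih₂ : χ₁ ∈ subformulas φ₂ → χ₂ ∈ subformulas φ₂ → χ₁ = χ₂)
    (hχ₁ : χ₁ = φ ∨ χ₁ ∈ subformulas φ₁ ∨ χ₁ ∈ subformulas φ₂)
    (hχ₂ : χ₂ = φ ∨ χ₂ ∈ subformulas φ₁ ∨ χ₂ ∈ subformulas φ₂) : χ₁ = χ₂ := by
  -- A literal of `ψ` shows on which side of `φ` its parents lie. A formula without literals, such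
  -- as `tt`, may have several parents.
  obtain ⟨l, hl⟩ := hψ
  have not_both : ¬ (l ∈ literals φ₁ ∧ l ∈ literals φ₂) := fun h =>
    Set.disjoint_left.1 hd h.1 h.2
  -- If `ψ` is itself a side of `φ`, a parent inside that side would be too large, and a parent
  -- inside the other side would share `l`.
  have not_proper : ∀ χ, ψ ∈ children φ → ψ ∈ children χ →
      χ ∈ subformulas φ₁ ∨ χ ∈ subformulas φ₂ → False := by
    intro χ hψ hχ hs
    rw [hφ] at hψ
    obtain rfl | rfl := hψ <;> obtain hs | hs := hs
    · exact absurd (sizeOf_lt_of_children hχ) (not_lt.2 (sizeOf_le_of_subformulas hs))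
    · exact not_both ⟨hl, literals_subset_of_children hs hχ hl⟩
    · exact not_both ⟨literals_subset_of_children hs hχ hl, hl⟩
    · exact absurd (sizeOf_lt_of_children hχ) (not_lt.2 (sizeOf_le_of_subformulas hs))
  obtain rfl | hχ₁ := hχ₁
  · obtain rfl | hχ₂ := hχ₂
    · rfl
    · exact (not_proper χ₂ h₁ h₂ hχ₂).elim
  · obtain rfl | hχ₂ := hχ₂
    · exact (not_proper χ₁ h₂ h₁ hχ₁).elim
    · obtain hχ₁ | hχ₁ := hχ₁ <;> obtain hχ₂ | hχ₂ := hχ₂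
      · exact ih₁ hχ₁ hχ₂
      · exact (not_both ⟨literals_subset_of_children hχ₁ h₁ hl,
          literals_subset_of_children hχ₂ h₂ hl⟩).elim
      · exact (not_both ⟨literals_subset_of_children hχ₂ h₂ hl,
          literals_subset_of_children hχ₁ h₁ hl⟩).elim
      · exact ih₂ hχ₁ hχ₂

/-- In a linear formula, a subformula containing a literal is an immediate subformula of at most
one subformula. -/
theorem parent_unique {φ χ₁ χ₂ ψ : LTL A} (hφ : Linear φ) (hψ : (literals ψ).Nonempty)
    (hχ₁ : χ₁ ∈ subformulas φ) (hχ₂ : χ₂ ∈ subformulas φ)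
    (h₁ : ψ ∈ children χ₁) (h₂ : ψ ∈ children χ₂) : χ₁ = χ₂ := by
  induction φ with
  | tt | ff | lit => obtain rfl := hχ₁; obtain rfl := hχ₂; rfl
  | next φ ih =>
    have not_proper : ∀ χ, ψ ∈ children (next φ) → ψ ∈ children χ → χ ∈ subformulas φ → False := by
      rintro χ rfl hχ hs
      exact absurd (sizeOf_lt_of_children hχ) (not_lt.2 (sizeOf_le_of_subformulas hs))
    obtain rfl | hχ₁ := hχ₁ <;> obtain rfl | hχ₂ := hχ₂
    · rfl
    · exact (not_proper χ₂ h₁ h₂ hχ₂).elim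
    · exact (not_proper χ₁ h₂ h₁ hχ₁).elim
    · exact ih hφ hχ₁ hχ₂
  | and φ₁ φ₂ ih₁ ih₂ | or φ₁ φ₂ ih₁ ih₂ | untl φ₁ φ₂ ih₁ ih₂ | release φ₁ φ₂ ih₁ ih₂ =>
    exact parent_unique_binary rfl hφ.2.2 hψ h₁ h₂ (ih₁ hφ.1) (ih₂ hφ.2.1) hχ₁ hχ₂

theorem conjuncts_subset_subformulas (φ : LTL A) : conjuncts φ ⊆ subformulas φ := by
  induction φ with
  | tt => exact Set.empty_subset _
  | and φ ψ ihφ ihψ => exact (Set.union_subset_union ihφ ihψ).trans Set.subset_union_right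
  | _ => rintro ψ rfl; exact self_mem_subformulas _

theorem disjuncts_subset_subformulas (φ : LTL A) : disjuncts φ ⊆ subformulas φ := by
  induction φ with
  | or φ ψ ihφ ihψ => exact (Set.union_subset_union ihφ ihψ).trans Set.subset_union_right
  | _ => rintro ψ rfl; exact self_mem_subformulas _

/-- Keeps reachable states within the subformulas of the initial formula; this gives finitely many
states and literals. -/
theorem normalForm_subset {φ : LTL A} {q : Set (Literal A) × Set (LTL A)}
    (hq : q ∈ normalForm φ) : q.1 ⊆ literals φ ∧ q.2 ⊆ subformulas φ := by
  induction φ generalizing q with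
  | tt => obtain rfl := hq; simp
  | ff => exact hq.elim
  | lit l => obtain rfl := hq; simp [literals]
  | next φ ih =>
    obtain ⟨ψ, hψ, rfl⟩ := hq
    refine ⟨Set.empty_subset _, fun θ hθ => .inr ?_⟩
    exact subformulas_trans (conjuncts_subset_subformulas _ hθ)
      (disjuncts_subset_subformulas _ hψ)
  | or φ ψ ihφ ihψ =>
    obtain hq | hq := hq
    · exact ⟨fun l hl => .inl ((ihφ hq).1 hl), fun l hl => .inr (.inl ((ihφ hq).2 hl))⟩
    · exact ⟨fun l hl => .inr ((ihψ hq).1 hl), fun l hl => .inr (.inr ((ihψ hq).2 hl))⟩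
  | and φ ψ ihφ ihψ =>
    obtain ⟨r, hr, s, hs, rfl⟩ := hq
    exact ⟨Set.union_subset_union (ihφ hr).1 (ihψ hs).1,
      (Set.union_subset_union (ihφ hr).2 (ihψ hs).2).trans Set.subset_union_right⟩
  | untl φ ψ ihφ ihψ =>
    obtain hq | ⟨r, hr, rfl⟩ := hq
    · exact ⟨fun l hl => .inr ((ihψ hq).1 hl), fun l hl => .inr (.inr ((ihψ hq).2 hl))⟩
    · refine ⟨fun l hl => .inl ((ihφ hr).1 hl), ?_⟩
      rintro θ (hθ | rfl)
      exacts [.inr (.inl ((ihφ hr).2 hθ)), self_mem_subformulas _]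
  | release φ ψ ihφ ihψ =>
    obtain ⟨r, hr, s, hs, rfl⟩ | ⟨r, hr, rfl⟩ := hq
    · exact ⟨Set.union_subset_union (ihφ hr).1 (ihψ hs).1,
        (Set.union_subset_union (ihφ hr).2 (ihψ hs).2).trans Set.subset_union_right⟩
    · refine ⟨fun l hl => .inr ((ihψ hr).1 hl), ?_⟩
      rintro θ (hθ | rfl)
      exacts [.inr (.inr ((ihψ hr).2 hθ)), self_mem_subformulas _]

/-- A formula none of whose literals belongs to `S` is valid if `S` weakly satisfies its
obligation formula. -/
theorem sat_of_weakSat_obligation {S : Set (Literal A)} {φ : LTL A}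
    (hS : Disjoint S (literals φ)) (h : φ.obligation.WeakSat S) (ξ : ℕ → Set (Literal A)) :
    Sat ξ φ := by
  induction φ generalizing ξ with
  | tt => trivial
  | ff => exact h
  | lit l => exact (Set.disjoint_left.1 hS h rfl).elim
  | next φ ih => exact ih hS h _
  | and φ ψ ihφ ihψ =>
    rw [literals, Set.disjoint_union_right] at hS
    exact ⟨ihφ hS.1 h.1 _, ihψ hS.2 h.2 _⟩
  | or φ ψ ihφ ihψ =>
    rw [literals, Set.disjoint_union_right] at hS
    exact h.imp (fun h => ihφ hS.1 h _) (fun h => ihψ hS.2 h _)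
  | untl φ ψ ihφ ihψ =>
    rw [literals, Set.disjoint_union_right] at hS
    exact ⟨0, ihψ hS.2 h _, by simp⟩
  | release φ ψ ihφ ihψ =>
    rw [literals, Set.disjoint_union_right] at hS
    exact .inl fun i => ihψ hS.2 h _

end Basic

/-! ### Where the formulas and literals of a run come from -/

section Run

variable {A : Type*} (α : ℕ → Set (Literal A)) (Ψ : ℕ → Set (LTL A))

/-- An element of the normal form of `φ` is realised by the `j`-th step of a run. -/
def Realised (j : ℕ) (φ : LTL A) : Prop :=
  ∃ q ∈ normalForm φ, q.1 ⊆ α j ∧ q.2 ⊆ Ψ (j + 1)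

/-- The realised formula `φ` is required at position `j` of a run because of a formula of which it
is an immediate subformula. -/
inductive Started : ℕ → LTL A → Prop
  | of_started {j φ χ} : Started j χ → φ ∈ children χ → Realised α Ψ j φ → Started j φ
  | of_mem {j φ χ} : χ ∈ Ψ j → φ ∈ children χ → Realised α Ψ j φ → Started j φ
  -- The operand of a `next` becomes due one position later; every other start happens at the
  -- position of the parent.
  | next_of_started {j φ} : Started j (next φ) → Realised α Ψ (j + 1) φ → Started (j + 1) φ
  | next_of_mem {j φ} : next φ ∈ Ψ j → Realised α Ψ (j + 1) φ → Started (j + 1) φ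

variable {α Ψ}

theorem Started.realised {j : ℕ} {φ : LTL A} (h : Started α Ψ j φ) : Realised α Ψ j φ := by
  cases h <;> assumption

theorem Started.mem_subformulas {φ₀ : LTL A} (hsub : ∀ j, Ψ j ⊆ subformulas φ₀) {j : ℕ} {φ : LTL A}
    (h : Started α Ψ j φ) : φ ∈ subformulas φ₀ := by
  induction h with
  | of_started _ hc _ ih => exact subformulas_trans (subformulas_of_children hc) ih
  | of_mem hm hc _ => exact subformulas_trans (subformulas_of_children hc) (hsub _ hm)
  | next_of_started _ _ ih => exact subformulas_trans (subformulas_of_children (φ := next _) rfl) ih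
  | next_of_mem hm _ =>
    exact subformulas_trans (subformulas_of_children (φ := next _) rfl) (hsub _ hm)

theorem realised_of_mem (hrun : ∀ j, (α j, Ψ (j + 1)) ∈ conjNormalForm (Ψ j)) {j : ℕ} {φ : LTL A}
    (h : φ ∈ Ψ j) : Realised α Ψ j φ := by
  obtain ⟨f, hf, he⟩ := hrun j
  rw [Prod.mk.injEq] at he
  rw [Realised, he.1, he.2]
  exact ⟨f φ, hf φ h, Set.subset_biUnion_of_mem (u := fun ψ => (f ψ).1) h,
    Set.subset_biUnion_of_mem (u := fun ψ => (f ψ).2) h⟩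

theorem realised_and {j : ℕ} {φ ψ : LTL A} :
    Realised α Ψ j (and φ ψ) ↔ Realised α Ψ j φ ∧ Realised α Ψ j ψ := by
  constructor
  · rintro ⟨_, ⟨r, hr, s, hs, rfl⟩, h₁, h₂⟩
    rw [Set.union_subset_iff] at h₁ h₂
    exact ⟨⟨r, hr, h₁.1, h₂.1⟩, ⟨s, hs, h₁.2, h₂.2⟩⟩
  · rintro ⟨⟨r, hr, h₁, h₂⟩, ⟨s, hs, h₃, h₄⟩⟩
    exact ⟨_, ⟨r, hr, s, hs, rfl⟩, Set.union_subset h₁ h₃, Set.union_subset h₂ h₄⟩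

theorem realised_or {j : ℕ} {φ ψ : LTL A} :
    Realised α Ψ j (or φ ψ) ↔ Realised α Ψ j φ ∨ Realised α Ψ j ψ := by
  constructor
  · rintro ⟨q, hq | hq, h⟩
    exacts [.inl ⟨q, hq, h⟩, .inr ⟨q, hq, h⟩]
  · rintro (⟨q, hq, h⟩ | ⟨q, hq, h⟩)
    exacts [⟨q, .inl hq, h⟩, ⟨q, .inr hq, h⟩]

theorem realised_of_conjuncts {j : ℕ} {φ : LTL A} (h : ∀ ψ ∈ conjuncts φ, Realised α Ψ j ψ) :
    Realised α Ψ j φ := by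
  induction φ with
  | tt => exact ⟨(∅, ∅), rfl, Set.empty_subset _, Set.empty_subset _⟩
  | and φ ψ ihφ ihψ =>
    exact realised_and.2 ⟨ihφ fun χ hχ => h χ (.inl hχ), ihψ fun χ hχ => h χ (.inr hχ)⟩
  | _ => exact h _ rfl

theorem realised_of_disjunct {j : ℕ} {φ ψ : LTL A} (hψ : ψ ∈ disjuncts φ)
    (h : Realised α Ψ j ψ) : Realised α Ψ j φ := by
  induction φ with
  | or φ₁ φ₂ ih₁ ih₂ => exact realised_or.2 (hψ.imp ih₁ ih₂)
  | _ => obtain rfl := hψ; exact h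

theorem Realised.next (hrun : ∀ j, (α j, Ψ (j + 1)) ∈ conjNormalForm (Ψ j)) {j : ℕ} {φ : LTL A}
    (h : Realised α Ψ j (next φ)) : Realised α Ψ (j + 1) φ := by
  obtain ⟨_, ⟨ψ, hψ, rfl⟩, -, h⟩ := h
  exact realised_of_disjunct hψ (realised_of_conjuncts fun χ hχ => realised_of_mem hrun (h hχ))

theorem Realised.untl {j : ℕ} {φ ψ : LTL A} (h : Realised α Ψ j (untl φ ψ)) :
    Realised α Ψ j ψ ∨ Realised α Ψ j φ ∧ LTL.untl φ ψ ∈ Ψ (j + 1) := by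
  obtain ⟨_, hq | ⟨r, hr, rfl⟩, h₁, h₂⟩ := h
  · exact .inl ⟨_, hq, h₁, h₂⟩
  · exact .inr ⟨⟨r, hr, h₁, fun θ hθ => h₂ (.inl hθ)⟩, h₂ (.inr rfl)⟩

theorem Realised.release {j : ℕ} {φ ψ : LTL A} (h : Realised α Ψ j (release φ ψ)) :
    Realised α Ψ j ψ ∧ (Realised α Ψ j φ ∨ LTL.release φ ψ ∈ Ψ (j + 1)) := by
  obtain ⟨_, ⟨r, hr, s, hs, rfl⟩ | ⟨r, hr, rfl⟩, h₁, h₂⟩ := h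
  · rw [Set.union_subset_iff] at h₁ h₂
    exact ⟨⟨s, hs, h₁.2, h₂.2⟩, .inl ⟨r, hr, h₁.1, h₂.1⟩⟩
  · exact ⟨⟨r, hr, h₁, fun θ hθ => h₂ (.inl hθ)⟩, .inr (h₂ (.inr rfl))⟩

theorem started_conjuncts {j : ℕ} {φ : LTL A} (h : Started α Ψ j φ) :
    ∀ ψ ∈ conjuncts φ, Started α Ψ j ψ := by
  induction φ with
  | tt => rintro ψ ⟨⟩
  | and φ ψ ihφ ihψ =>
    have hr := realised_and.1 h.realised
    rintro χ (hχ | hχ)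
    · exact ihφ (.of_started h (.inl rfl) hr.1) χ hχ
    · exact ihψ (.of_started h (.inr rfl) hr.2) χ hχ
  | _ => rintro ψ rfl; exact h

theorem started_disjunct {j : ℕ} {φ ψ : LTL A} (h : Started α Ψ j φ) (hψ : ψ ∈ disjuncts φ)
    (hr : Realised α Ψ j ψ) : Started α Ψ j ψ := by
  induction φ with
  | or φ₁ φ₂ ih₁ ih₂ =>
    obtain hψ | hψ := hψ
    · exact ih₁ (.of_started h (.inl rfl) (realised_of_disjunct hψ hr)) hψ
    · exact ih₂ (.of_started h (.inr rfl) (realised_of_disjunct hψ hr)) hψ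
  | _ => obtain rfl := hψ; exact h

/-- The literals and formulas contributed by a formula active at position `j` are started there or
at the next position, unless they are active already. -/
theorem started_of_mem_normalForm (hrun : ∀ j, (α j, Ψ (j + 1)) ∈ conjNormalForm (Ψ j))
    {j : ℕ} {φ : LTL A} (hφ : Started α Ψ j φ ∨ φ ∈ Ψ j) {q : Set (Literal A) × Set (LTL A)}
    (hq : q ∈ normalForm φ) (h₁ : q.1 ⊆ α j) (h₂ : q.2 ⊆ Ψ (j + 1)) :
    (∀ l ∈ q.1, Started α Ψ j (lit l) ∨ lit l ∈ Ψ j) ∧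
      ∀ θ ∈ q.2, Started α Ψ (j + 1) θ ∨ Started α Ψ j θ ∨ θ ∈ Ψ j := by
  have start : ∀ {χ}, χ ∈ children φ → Realised α Ψ j χ → Started α Ψ j χ ∨ χ ∈ Ψ j :=
    fun hc hr => .inl (hφ.elim (fun h => .of_started h hc hr) (fun h => .of_mem h hc hr))
  induction φ generalizing q with
  | tt => obtain rfl := hq; simp
  | ff => exact hq.elim
  | lit l =>
    obtain rfl := hq
    refine ⟨?_, by simp⟩
    rintro _ rfl
    exact hφ
  | next φ ih =>
    obtain ⟨ψ, hψ, rfl⟩ := hq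
    refine ⟨by simp, fun θ hθ => .inl ?_⟩
    have hr : Realised α Ψ (j + 1) ψ :=
      realised_of_conjuncts fun χ hχ => realised_of_mem hrun (h₂ hχ)
    have hr' := realised_of_disjunct hψ hr
    have hs : Started α Ψ (j + 1) φ :=
      hφ.elim (fun h => .next_of_started h hr') (fun h => .next_of_mem h hr')
    exact started_conjuncts (started_disjunct hs hψ hr) θ hθ
  | or φ ψ ihφ ihψ =>
    obtain hq | hq := hq
    · have := start (.inl rfl) ⟨q, hq, h₁, h₂⟩
      exact ihφ this hq h₁ h₂ fun hc hr =>
        .inl (this.elim (fun h => .of_started h hc hr) (fun h => .of_mem h hc hr))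
    · have := start (.inr rfl) ⟨q, hq, h₁, h₂⟩
      exact ihψ this hq h₁ h₂ fun hc hr =>
        .inl (this.elim (fun h => .of_started h hc hr) (fun h => .of_mem h hc hr))
  | and φ ψ ihφ ihψ =>
    obtain ⟨r, hr, s, hs, rfl⟩ := hq
    rw [Set.union_subset_iff] at h₁ h₂
    have hr' := start (.inl rfl) ⟨r, hr, h₁.1, h₂.1⟩
    have hs' := start (.inr rfl) ⟨s, hs, h₁.2, h₂.2⟩
    have hr'' := ihφ hr' hr h₁.1 h₂.1 fun hc hr =>
      .inl (hr'.elim (fun h => .of_started h hc hr) (fun h => .of_mem h hc hr))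
    have hs'' := ihψ hs' hs h₁.2 h₂.2 fun hc hr =>
      .inl (hs'.elim (fun h => .of_started h hc hr) (fun h => .of_mem h hc hr))
    exact ⟨fun l hl => hl.elim (hr''.1 l) (hs''.1 l), fun θ hθ => hθ.elim (hr''.2 θ) (hs''.2 θ)⟩
  | untl φ ψ ihφ ihψ =>
    obtain hq | ⟨r, hr, rfl⟩ := hq
    · have := start (.inr rfl) ⟨q, hq, h₁, h₂⟩
      exact ihψ this hq h₁ h₂ fun hc hr =>
        .inl (this.elim (fun h => .of_started h hc hr) (fun h => .of_mem h hc hr))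
    · rw [Set.union_subset_iff] at h₂
      have hr' := start (.inl rfl) ⟨r, hr, h₁, h₂.1⟩
      have hr'' := ihφ hr' hr h₁ h₂.1 fun hc hr =>
        .inl (hr'.elim (fun h => .of_started h hc hr) (fun h => .of_mem h hc hr))
      refine ⟨hr''.1, ?_⟩
      rintro θ (hθ | rfl)
      -- The until carried over to the next state is not started again, but it is active at `j`
      -- already.
      exacts [hr''.2 θ hθ, .inr hφ]
  | release φ ψ ihφ ihψ =>
    obtain ⟨r, hr, s, hs, rfl⟩ | ⟨r, hr, rfl⟩ := hq
    · rw [Set.union_subset_iff] at h₁ h₂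
      have hr' := start (.inl rfl) ⟨r, hr, h₁.1, h₂.1⟩
      have hs' := start (.inr rfl) ⟨s, hs, h₁.2, h₂.2⟩
      have hr'' := ihφ hr' hr h₁.1 h₂.1 fun hc hr =>
        .inl (hr'.elim (fun h => .of_started h hc hr) (fun h => .of_mem h hc hr))
      have hs'' := ihψ hs' hs h₁.2 h₂.2 fun hc hr =>
        .inl (hs'.elim (fun h => .of_started h hc hr) (fun h => .of_mem h hc hr))
      exact ⟨fun l hl => hl.elim (hr''.1 l) (hs''.1 l), fun θ hθ => hθ.elim (hr''.2 θ) (hs''.2 θ)⟩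
    · rw [Set.union_subset_iff] at h₂
      have hr' := start (.inr rfl) ⟨r, hr, h₁, h₂.1⟩
      have hr'' := ihψ hr' hr h₁ h₂.1 fun hc hr =>
        .inl (hr'.elim (fun h => .of_started h hc hr) (fun h => .of_mem h hc hr))
      refine ⟨hr''.1, ?_⟩
      rintro θ (hθ | rfl)
      exacts [hr''.2 θ hθ, .inr hφ]

/-- Used in the contrapositive: a literal that is inactive from some position on disappears from the
labels. -/
theorem active_of_mem_label (hrun : ∀ j, (α j, Ψ (j + 1)) ∈ conjNormalForm (Ψ j)) {j : ℕ}
    {l : Literal A} (hl : l ∈ α j) : Started α Ψ j (lit l) ∨ lit l ∈ Ψ j := by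
  obtain ⟨f, hf, he⟩ := hrun j
  rw [Prod.mk.injEq] at he
  have hl' := hl
  rw [he.1, Set.mem_iUnion₂] at hl'
  obtain ⟨φ, hφ, hl'⟩ := hl'
  refine (started_of_mem_normalForm hrun (.inr hφ) (hf φ hφ) ?_ ?_).1 l hl'
  · rw [he.1]; exact Set.subset_biUnion_of_mem (u := fun ψ => (f ψ).1) hφ
  · rw [he.2]; exact Set.subset_biUnion_of_mem (u := fun ψ => (f ψ).2) hφ

/-- Only until and release reproduce themselves; everything else in the next state comes out of a
`next`, which starts it there. -/
theorem active_of_mem_succ (hrun : ∀ j, (α j, Ψ (j + 1)) ∈ conjNormalForm (Ψ j)) {j : ℕ}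
    {θ : LTL A} (hθ : θ ∈ Ψ (j + 1)) :
    Started α Ψ (j + 1) θ ∨ Started α Ψ j θ ∨ θ ∈ Ψ j := by
  obtain ⟨f, hf, he⟩ := hrun j
  rw [Prod.mk.injEq] at he
  have hθ' := hθ
  rw [he.2, Set.mem_iUnion₂] at hθ'
  obtain ⟨φ, hφ, hθ'⟩ := hθ'
  refine (started_of_mem_normalForm hrun (.inr hφ) (hf φ hφ) ?_ ?_).2 θ hθ'
  · rw [he.1]; exact Set.subset_biUnion_of_mem (u := fun ψ => (f ψ).1) hφ
  · rw [he.2]; exact Set.subset_biUnion_of_mem (u := fun ψ => (f ψ).2) hφ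

/-- Once the starts have ceased, a formula that is dropped from one state can never return. -/
theorem eventually_mem_or_inactive (hrun : ∀ j, (α j, Ψ (j + 1)) ∈ conjNormalForm (Ψ j))
    {φ : LTL A} (h : ∀ᶠ j in atTop, ¬ Started α Ψ j φ) :
    (∀ᶠ j in atTop, φ ∈ Ψ j) ∨ ∀ᶠ j in atTop, ¬ (Started α Ψ j φ ∨ φ ∈ Ψ j) := by
  obtain ⟨N, hN⟩ := eventually_atTop.1 h
  by_cases hmem : ∀ j ≥ N, φ ∈ Ψ j
  · exact .inl (eventually_atTop.2 ⟨N, hmem⟩)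
  · right
    push Not at hmem
    obtain ⟨M, hM, hφ⟩ := hmem
    have : ∀ j ≥ M, φ ∉ Ψ j := by
      intro j hj
      induction j, hj using Nat.le_induction with
      | base => exact hφ
      | succ j hj ih =>
        intro hmem
        obtain h | h | h := active_of_mem_succ hrun hmem
        exacts [hN _ (by omega) h, hN _ (by omega) h, ih h]
    exact eventually_atTop.2 ⟨M, fun j hj h => h.elim (hN j (by omega)) (this j hj)⟩

/-- By linearity `χ` is the only possible parent of `φ`, so each start of `φ` needs `χ` active at
the same or the preceding position. -/
theorem eventually_not_started_child {φ₀ : LTL A} (hsub : ∀ j, Ψ j ⊆ subformulas φ₀)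
    (hlin : Linear φ₀) {φ χ : LTL A} (hχ : χ ∈ subformulas φ₀) (hφ : φ ∈ children χ)
    (hne : (literals φ).Nonempty) (h : ∀ᶠ j in atTop, ¬ (Started α Ψ j χ ∨ χ ∈ Ψ j)) :
    ∀ᶠ j in atTop, ¬ Started α Ψ j φ := by
  obtain ⟨N, hN⟩ := eventually_atTop.1 h
  -- The extra position allows for the delay of a `next`.
  refine eventually_atTop.2 ⟨N + 1, fun j hj hs => ?_⟩
  cases hs with
  | of_started h hc _ =>
    obtain rfl := parent_unique hlin hne hχ (h.mem_subformulas hsub) hφ hc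
    exact hN _ (by omega) (.inl h)
  | of_mem h hc _ =>
    obtain rfl := parent_unique hlin hne hχ (hsub _ h) hφ hc
    exact hN _ (by omega) (.inr h)
  | next_of_started h' _ =>
    obtain rfl := parent_unique hlin hne hχ (h'.mem_subformulas hsub) hφ rfl
    exact hN _ (by omega) (.inl h')
  | next_of_mem h' _ =>
    obtain rfl := parent_unique hlin hne hχ (hsub _ h') hφ rfl
    exact hN _ (by omega) (.inr h')

/-! ### Truth of realised formulas -/

/-- As long as `ψ` fails, the until is passed from state to state; `hev` excludes that this goes on
forever. -/
theorem sat_untl_of_realised (hrun : ∀ j, (α j, Ψ (j + 1)) ∈ conjNormalForm (Ψ j))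
    {φ ψ : LTL A} (hφ : ∀ j, Realised α Ψ j φ → Sat (suffix α j) φ)
    (hψ : ∀ j, Realised α Ψ j ψ → Sat (suffix α j) ψ)
    (hev : (∃ᶠ j in atTop, Sat (suffix α j) ψ) ∨ ∃ᶠ j in atTop, untl φ ψ ∉ Ψ j)
    {j : ℕ} (h : Realised α Ψ j (untl φ ψ)) : Sat (suffix α j) (untl φ ψ) := by
  classical
  simp only [sat_untl, suffix_suffix]
  have step : ∀ i, (∀ k < i, ¬ Sat (suffix α (j + k)) ψ) → Realised α Ψ (j + i) (untl φ ψ) := by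
    intro i
    induction i with
    | zero => exact fun _ => h
    | succ i ih =>
      intro hi
      obtain h' | h' := (ih fun k hk => hi k (by omega)).untl
      · exact (hi i (by omega) (hψ _ h')).elim
      · exact realised_of_mem hrun h'.2
  have hex : ∃ i, Sat (suffix α (j + i)) ψ := by
    by_contra hno
    push Not at hno
    obtain hev | hev := hev
    · obtain ⟨k, hk, h'⟩ := (frequently_atTop.1 hev) j
      obtain ⟨i, rfl⟩ := Nat.exists_eq_add_of_le hk
      exact hno i h'
    · obtain ⟨k, hk, h'⟩ := (frequently_atTop.1 hev) (j + 1)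
      obtain ⟨i, rfl⟩ := Nat.exists_eq_add_of_le hk
      obtain h'' | h'' := (step i fun k _ => hno k).untl
      · exact hno i (hψ _ h'')
      · exact h' (by rw [Nat.add_right_comm]; exact h''.2)
  refine ⟨Nat.find hex, Nat.find_spec hex, fun i hi => ?_⟩
  obtain h' | h' := (step i fun k hk => Nat.find_min hex (hk.trans hi)).untl
  · exact (Nat.find_min hex hi (hψ _ h')).elim
  · exact hφ _ h'.1

/-- No fairness is needed here: a release that is passed on forever is true. -/
theorem sat_release_of_realised (hrun : ∀ j, (α j, Ψ (j + 1)) ∈ conjNormalForm (Ψ j))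
    {φ ψ : LTL A} (hφ : ∀ j, Realised α Ψ j φ → Sat (suffix α j) φ)
    (hψ : ∀ j, Realised α Ψ j ψ → Sat (suffix α j) ψ)
    {j : ℕ} (h : Realised α Ψ j (release φ ψ)) : Sat (suffix α j) (release φ ψ) := by
  classical
  simp only [sat_release, suffix_suffix]
  have step : ∀ i, (∀ k < i, ¬ Sat (suffix α (j + k)) φ) →
      Realised α Ψ (j + i) (release φ ψ) := by
    intro i
    induction i with
    | zero => exact fun _ => h
    | succ i ih =>
      intro hi
      obtain ⟨-, h' | h'⟩ := (ih fun k hk => hi k (by omega)).release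
      · exact (hi i (by omega) (hφ _ h')).elim
      · exact realised_of_mem hrun h'
  by_cases hex : ∃ i, Sat (suffix α (j + i)) φ
  · have hψ' : ∀ i ≤ Nat.find hex, Sat (suffix α (j + i)) ψ := fun i hi =>
      hψ _ (step i fun k hk => Nat.find_min hex (by omega)).release.1
    exact .inr ⟨Nat.find hex, ⟨Nat.find_spec hex, hψ' _ le_rfl⟩, fun i hi => hψ' i hi.le⟩
  · push Not at hex
    exact .inl fun i => hψ _ (step i fun k _ => hex k).release.1

/-- A run of a linear formula that, infinitely often, visits a state whose obligation is weakly
satisfied by the literals used infinitely often satisfies every formula that it realises. The second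
conjunct, on formulas started only finitely often, makes the induction go through. -/
theorem sat_of_realised_aux (hrun : ∀ j, (α j, Ψ (j + 1)) ∈ conjNormalForm (Ψ j)) {φ₀ : LTL A}
    (hsub : ∀ j, Ψ j ⊆ subformulas φ₀) (hlin : Linear φ₀) {L : Set (Literal A)}
    (hL : ∀ l ∈ L, ∃ᶠ j in atTop, l ∈ α j)
    (hΨ : ∃ᶠ j in atTop, ∀ ψ ∈ Ψ j, ψ.obligation.WeakSat L) {χ : LTL A}
    (hχ : χ ∈ subformulas φ₀) :
    (∀ j, Realised α Ψ j χ → Sat (suffix α j) χ) ∧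
      (χ.obligation.WeakSat L → (∀ᶠ j in atTop, ¬ Started α Ψ j χ) →
        ∀ᶠ j in atTop, Sat (suffix α j) χ) := by
  have mem : ∀ {χ φ : LTL A}, χ ∈ subformulas φ₀ → φ ∈ children χ → φ ∈ subformulas φ₀ :=
    fun hχ hφ => subformulas_trans (subformulas_of_children hφ) hχ
  have child : ∀ {χ φ : LTL A}, χ ∈ subformulas φ₀ → φ ∈ children χ →
      (φ.obligation.WeakSat L → (∀ᶠ j in atTop, ¬ Started α Ψ j φ) →
        ∀ᶠ j in atTop, Sat (suffix α j) φ) →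
      (∀ᶠ j in atTop, ¬ (Started α Ψ j χ ∨ χ ∈ Ψ j)) → φ.obligation.WeakSat L →
      ∀ᶠ j in atTop, Sat (suffix α j) φ := by
    intro χ φ hχ hφ ih hin hw
    -- Formulas without literals escape `parent_unique`, but are valid once their obligation is
    -- weakly satisfied.
    obtain he | hne := (literals φ).eq_empty_or_nonempty
    · exact .of_forall fun j => sat_of_weakSat_obligation (by simp [he]) hw _
    · exact ih hw (eventually_not_started_child hsub hlin hχ hφ hne hin)
  -- A formula no longer started either stays in the states, where it is realised and so true, or
  -- becomes inactive; only the latter case is left to the induction.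
  have split : ∀ {χ : LTL A}, (∀ j, Realised α Ψ j χ → Sat (suffix α j) χ) →
      ((∀ᶠ j in atTop, ¬ (Started α Ψ j χ ∨ χ ∈ Ψ j)) → χ.obligation.WeakSat L →
        ∀ᶠ j in atTop, Sat (suffix α j) χ) →
      (∀ j, Realised α Ψ j χ → Sat (suffix α j) χ) ∧
      (χ.obligation.WeakSat L → (∀ᶠ j in atTop, ¬ Started α Ψ j χ) →
        ∀ᶠ j in atTop, Sat (suffix α j) χ) := by
    refine fun hT hQ => ⟨hT, fun hw hns => ?_⟩
    obtain h | h := eventually_mem_or_inactive hrun hns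
    · exact h.mono fun j hj => hT j (realised_of_mem hrun hj)
    · exact hQ h hw
  induction χ with
  | tt => exact split (fun _ _ => trivial) fun _ _ => .of_forall fun _ => trivial
  | ff => exact split (fun j ⟨_, h, _⟩ => h.elim) fun _ h => h.elim
  | lit l =>
    refine split (fun j ⟨q, hq, h, _⟩ => ?_) fun hin hl => ?_
    · obtain rfl := hq; exact h rfl
    -- A literal of `L` recurs in the labels, so it cannot become inactive.
    · obtain ⟨j, hj, hj'⟩ := ((hL l hl).and_eventually hin).exists
      exact (hj' (active_of_mem_label hrun hj)).elim
  | next φ ih =>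
    obtain ⟨hT, hQ⟩ := ih (mem hχ rfl)
    refine split (fun j h => ?_) fun hin hw => ?_
    · rw [sat_next, suffix_suffix]
      exact hT _ (h.next hrun)
    · simp only [sat_next, suffix_suffix]
      exact (tendsto_add_atTop_nat 1).eventually (child hχ rfl hQ hin hw)
  | and φ ψ ihφ ihψ =>
    obtain ⟨hTφ, hQφ⟩ := ihφ (mem hχ (.inl rfl))
    obtain ⟨hTψ, hQψ⟩ := ihψ (mem hχ (.inr rfl))
    refine split (fun j h => (realised_and.1 h).imp (hTφ j) (hTψ j)) fun hin hw => ?_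
    exact (child hχ (.inl rfl) hQφ hin hw.1).and (child hχ (.inr rfl) hQψ hin hw.2)
  | or φ ψ ihφ ihψ =>
    obtain ⟨hTφ, hQφ⟩ := ihφ (mem hχ (.inl rfl))
    obtain ⟨hTψ, hQψ⟩ := ihψ (mem hχ (.inr rfl))
    refine split (fun j h => (realised_or.1 h).imp (hTφ j) (hTψ j)) fun hin hw => ?_
    obtain hw | hw := hw
    · exact (child hχ (.inl rfl) hQφ hin hw).mono fun j h => .inl h
    · exact (child hχ (.inr rfl) hQψ hin hw).mono fun j h => .inr h
  | untl φ ψ ihφ ihψ =>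
    obtain ⟨hTφ, hQφ⟩ := ihφ (mem hχ (.inl rfl))
    obtain ⟨hTψ, hQψ⟩ := ihψ (mem hχ (.inr rfl))
    refine split (fun j h => sat_untl_of_realised hrun hTφ hTψ ?_ h) fun hin hw => ?_
    -- If the until lies in all late states, a visit to a state with satisfied obligations puts the
    -- obligation of `ψ` within `L`.
    · rw [or_iff_not_imp_right, not_frequently]
      intro hmem
      simp only [not_not] at hmem
      obtain ⟨k, hk, hk'⟩ := (hΨ.and_eventually hmem).exists
      by_cases hs : ∃ᶠ j in atTop, Started α Ψ j ψ
      · exact hs.mono fun j hj => hTψ j hj.realised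
      · exact (hQψ (hk (untl φ ψ) hk') (not_frequently.1 hs)).frequently
    · refine (child hχ (.inr rfl) hQψ hin hw).mono fun j h => ?_
      exact sat_untl_unfold.2 (.inl h)
  | release φ ψ ihφ ihψ =>
    obtain ⟨hTφ, hQφ⟩ := ihφ (mem hχ (.inl rfl))
    obtain ⟨hTψ, hQψ⟩ := ihψ (mem hχ (.inr rfl))
    refine split (fun j h => sat_release_of_realised hrun hTφ hTψ h) fun hin hw => ?_
    obtain ⟨N, hN⟩ := eventually_atTop.1 (child hχ (.inr rfl) hQψ hin hw)
    refine eventually_atTop.2 ⟨N, fun j hj => .inl fun i => ?_⟩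
    have := hN (j + i) (by omega)
    rwa [← suffix_suffix] at this

end Run

/-! ### The run guided by a model -/

section Pick

variable {A : Type*}

open Classical in
/-- A disjunct that holds at the beginning of `ξ`, if there is one. -/
noncomputable def pickDisjunct (ξ : ℕ → Set (Literal A)) : LTL A → LTL A
  | or φ ψ => if Sat ξ φ then pickDisjunct ξ φ else pickDisjunct ξ ψ
  | φ => φ

open Classical in
/-- The element of the normal form chosen along `ξ`; the eventuality of `untl` is fulfilled as soon
as possible. -/
noncomputable def pick (ξ : ℕ → Set (Literal A)) : LTL A → Set (Literal A) × Set (LTL A)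
  | tt => (∅, ∅)
  | ff => (∅, ∅)
  | lit l => ({l}, ∅)
  | and φ ψ => ((pick ξ φ).1 ∪ (pick ξ ψ).1, (pick ξ φ).2 ∪ (pick ξ ψ).2)
  | or φ ψ => if Sat ξ φ then pick ξ φ else pick ξ ψ
  | next φ => (∅, conjuncts (pickDisjunct (suffix ξ 1) φ))
  | untl φ ψ =>
      if Sat ξ ψ then pick ξ ψ else ((pick ξ φ).1, (pick ξ φ).2 ∪ {untl φ ψ})
  | release φ ψ =>
      if Sat ξ φ then ((pick ξ φ).1 ∪ (pick ξ ψ).1, (pick ξ φ).2 ∪ (pick ξ ψ).2)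
      else ((pick ξ ψ).1, (pick ξ ψ).2 ∪ {release φ ψ})

theorem pickDisjunct_spec {ξ : ℕ → Set (Literal A)} {φ : LTL A} (h : Sat ξ φ) :
    pickDisjunct ξ φ ∈ disjuncts φ ∧ Sat ξ (pickDisjunct ξ φ) := by
  induction φ with
  | or φ ψ ihφ ihψ =>
    rw [pickDisjunct]
    split_ifs with hφ
    · exact ⟨.inl (ihφ hφ).1, (ihφ hφ).2⟩
    · have hψ := h.resolve_left hφ
      exact ⟨.inr (ihψ hψ).1, (ihψ hψ).2⟩
  | _ => exact ⟨rfl, h⟩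

/-- Both functions decide a disjunction by the same test. -/
theorem pick_pickDisjunct (ξ : ℕ → Set (Literal A)) (φ : LTL A) :
    pick ξ (pickDisjunct ξ φ) = pick ξ φ := by
  induction φ with
  | or φ ψ ihφ ihψ =>
    rw [pickDisjunct, pick]
    split_ifs
    exacts [ihφ, ihψ]
  | _ => rfl

/-- Below a `next`, only the conjuncts of a disjunct enter the next state; this recovers the choice
for the whole operand. -/
theorem pick_subset_of_conjuncts {ξ : ℕ → Set (Literal A)} {φ : LTL A} {S : Set (Literal A)}
    {Ψ : Set (LTL A)} (h : ∀ ψ ∈ conjuncts φ, (pick ξ ψ).1 ⊆ S ∧ (pick ξ ψ).2 ⊆ Ψ) :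
    (pick ξ φ).1 ⊆ S ∧ (pick ξ φ).2 ⊆ Ψ := by
  induction φ with
  | tt => exact ⟨Set.empty_subset _, Set.empty_subset _⟩
  | and φ ψ ihφ ihψ =>
    have hφ := ihφ fun χ hχ => h χ (.inl hχ)
    have hψ := ihψ fun χ hχ => h χ (.inr hχ)
    exact ⟨Set.union_subset hφ.1 hψ.1, Set.union_subset hφ.2 hψ.2⟩
  | _ => exact h _ rfl

theorem pick_spec {ξ : ℕ → Set (Literal A)} {φ : LTL A} (h : Sat ξ φ) :
    pick ξ φ ∈ normalForm φ ∧ (pick ξ φ).1 ⊆ ξ 0 ∧ ∀ θ ∈ (pick ξ φ).2, Sat (suffix ξ 1) θ := by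
  induction φ with
  | tt => exact ⟨rfl, Set.empty_subset _, fun _ h => h.elim⟩
  | ff => exact h.elim
  | lit l => exact ⟨rfl, Set.singleton_subset_iff.2 h, fun _ h => h.elim⟩
  | next φ ih =>
    obtain ⟨h₁, h₂⟩ := pickDisjunct_spec (sat_next.1 h)
    exact ⟨⟨_, h₁, rfl⟩, Set.empty_subset _, sat_conjuncts h₂⟩
  | and φ ψ ihφ ihψ =>
    obtain ⟨a₁, a₂, a₃⟩ := ihφ h.1
    obtain ⟨b₁, b₂, b₃⟩ := ihψ h.2
    exact ⟨⟨_, a₁, _, b₁, rfl⟩, Set.union_subset a₂ b₂, fun θ hθ => hθ.elim (a₃ θ) (b₃ θ)⟩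
  | or φ ψ ihφ ihψ =>
    rw [pick]
    split_ifs with hφ
    · exact ⟨.inl (ihφ hφ).1, (ihφ hφ).2⟩
    · have hψ := h.resolve_left hφ
      exact ⟨.inr (ihψ hψ).1, (ihψ hψ).2⟩
  | untl φ ψ ihφ ihψ =>
    rw [pick]
    split_ifs with hψ
    · exact ⟨.inl (ihψ hψ).1, (ihψ hψ).2⟩
    · obtain ⟨hφ, hn⟩ := (sat_untl_unfold.1 h).resolve_left hψ
      obtain ⟨a₁, a₂, a₃⟩ := ihφ hφ
      refine ⟨.inr ⟨_, a₁, rfl⟩, a₂, ?_⟩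
      rintro θ (hθ | rfl)
      exacts [a₃ θ hθ, hn]
  | release φ ψ ihφ ihψ =>
    obtain ⟨hψ, h'⟩ := sat_release_unfold.1 h
    obtain ⟨b₁, b₂, b₃⟩ := ihψ hψ
    rw [pick]
    split_ifs with hφ
    · obtain ⟨a₁, a₂, a₃⟩ := ihφ hφ
      exact ⟨.inl ⟨_, a₁, _, b₁, rfl⟩, Set.union_subset a₂ b₂,
        fun θ hθ => hθ.elim (a₃ θ) (b₃ θ)⟩
    · refine ⟨.inr ⟨_, b₁, rfl⟩, b₂, ?_⟩
      rintro θ (hθ | rfl)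
      exacts [b₃ θ hθ, h'.resolve_left hφ]

/-- Along a run that follows `pick`, the obligation of every formula that holds is weakly satisfied
by the literals used from that position on. -/
theorem weakSat_obligation_of_pick {ξ : ℕ → Set (Literal A)} {α : ℕ → Set (Literal A)}
    {Ψ : ℕ → Set (LTL A)} {L : Set (Literal A)} {N : ℕ}
    (hpick : ∀ j, ∀ ψ ∈ Ψ j,
      (pick (suffix ξ j) ψ).1 ⊆ α j ∧ (pick (suffix ξ j) ψ).2 ⊆ Ψ (j + 1))
    (hL : ∀ j ≥ N, α j ⊆ L) {φ : LTL A} {j : ℕ} (hj : N ≤ j) (hs : Sat (suffix ξ j) φ)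
    (h₁ : (pick (suffix ξ j) φ).1 ⊆ α j) (h₂ : (pick (suffix ξ j) φ).2 ⊆ Ψ (j + 1)) :
    φ.obligation.WeakSat L := by
  induction φ generalizing j with
  | tt => trivial
  | ff => exact hs
  | lit l => exact hL j hj (h₁ rfl)
  | next φ ih =>
    rw [sat_next, suffix_suffix] at hs
    rw [pick, suffix_suffix] at h₂
    have := pick_subset_of_conjuncts fun ψ hψ => hpick (j + 1) ψ (h₂ hψ)
    rw [pick_pickDisjunct] at this
    exact ih (by omega) hs this.1 this.2
  | and φ ψ ihφ ihψ =>
    rw [pick, Set.union_subset_iff] at h₁ h₂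
    exact ⟨ihφ hj hs.1 h₁.1 h₂.1, ihψ hj hs.2 h₁.2 h₂.2⟩
  | or φ ψ ihφ ihψ =>
    rw [pick] at h₁ h₂
    split_ifs at h₁ h₂ with hφ
    · exact .inl (ihφ hj hφ h₁ h₂)
    · exact .inr (ihψ hj (hs.resolve_left hφ) h₁ h₂)
  | untl φ ψ ihφ ihψ =>
    obtain ⟨i, hi, -⟩ := id hs
    change Sat (suffix (suffix ξ j) i) ψ at hi
    rw [suffix_suffix] at hi
    -- Induction on the distance to a position where `ψ` holds: an unfulfilled until is in the next
    -- state, one step closer to it.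
    induction i generalizing j with
    | zero =>
      rw [Nat.add_zero] at hi
      rw [pick, if_pos hi] at h₁ h₂
      exact ihψ hj hi h₁ h₂
    | succ i ih =>
      by_cases hψ : Sat (suffix ξ j) ψ
      · rw [pick, if_pos hψ] at h₁ h₂
        exact ihψ hj hψ h₁ h₂
      · rw [pick, if_neg hψ] at h₂
        have hm : untl φ ψ ∈ Ψ (j + 1) := h₂ (.inr rfl)
        have hn := ((sat_untl_unfold.1 hs).resolve_left hψ).2
        rw [suffix_suffix] at hn
        have := hpick _ _ hm
        exact ih (by omega) hn this.1 this.2 (by rwa [Nat.add_assoc, Nat.add_comm 1])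
  | release φ ψ ihφ ihψ =>
    have hψ := (sat_release_unfold.1 hs).1
    rw [pick] at h₁ h₂
    split_ifs at h₁ h₂ with hφ
    · rw [Set.union_subset_iff] at h₁ h₂
      exact ihψ hj hψ h₁.2 h₂.2
    · exact ihψ hj hψ h₁ fun θ hθ => h₂ (.inl hθ)

end Pick

/-! ### Tagging preserves satisfiability and yields linear formulas -/

section Tag

variable {A : Type*}

theorem sat_untag {ξ : ℕ → Set (Literal (A × List Bool))} {p : List Bool} {φ : LTL A}
    (h : Sat ξ (tagFrom p φ)) : Sat (fun n => Literal.map Prod.fst '' ξ n) φ := by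
  induction φ generalizing ξ p with
  | tt => trivial
  | ff => exact h
  | lit l => exact ⟨_, h, Literal.map_fst_map p l⟩
  | next φ ih => exact ih (ξ := suffix ξ 1) h
  | and φ ψ ihφ ihψ => exact ⟨ihφ h.1, ihψ h.2⟩
  | or φ ψ ihφ ihψ => exact h.imp ihφ ihψ
  | untl φ ψ ihφ ihψ =>
    obtain ⟨i, hi, h⟩ := h
    exact ⟨i, ihψ (ξ := suffix ξ i) hi, fun j hj => ihφ (ξ := suffix ξ j) (h j hj)⟩
  | release φ ψ ihφ ihψ =>
    obtain h | ⟨i, hi, h⟩ := h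
    · exact .inl fun i => ihψ (ξ := suffix ξ i) (h i)
    · exact .inr ⟨i, ⟨ihφ (ξ := suffix ξ i) hi.1, ihψ (ξ := suffix ξ i) hi.2⟩,
        fun j hj => ihψ (ξ := suffix ξ j) (h j hj)⟩

theorem sat_tagFrom {ξ : ℕ → Set (Literal A)} {p : List Bool} {φ : LTL A} (h : Sat ξ φ) :
    Sat (fun n => {l : Literal (A × List Bool) | l.map Prod.fst ∈ ξ n}) (tagFrom p φ) := by
  induction φ generalizing ξ p with
  | tt => trivial
  | ff => exact h
  | lit l =>
    change (l.map _).map _ ∈ ξ 0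
    rwa [Literal.map_fst_map]
  | next φ ih => exact ih (ξ := suffix ξ 1) h
  | and φ ψ ihφ ihψ => exact ⟨ihφ h.1, ihψ h.2⟩
  | or φ ψ ihφ ihψ => exact h.imp ihφ ihψ
  | untl φ ψ ihφ ihψ =>
    obtain ⟨i, hi, h⟩ := h
    exact ⟨i, ihψ (ξ := suffix ξ i) hi, fun j hj => ihφ (ξ := suffix ξ j) (h j hj)⟩
  | release φ ψ ihφ ihψ =>
    obtain h | ⟨i, hi, h⟩ := h
    · exact .inl fun i => ihψ (ξ := suffix ξ i) (h i)
    · exact .inr ⟨i, ⟨ihφ (ξ := suffix ξ i) hi.1, ihψ (ξ := suffix ξ i) hi.2⟩,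
        fun j hj => ihψ (ξ := suffix ξ j) (h j hj)⟩

/-- Addresses grow at the head, so that of a subtree remains a suffix; the entry in front of it
separates left from right. -/
theorem isSuffix_of_mem_literals_tagFrom {p : List Bool} {φ : LTL A}
    {l : Literal (A × List Bool)} (h : l ∈ literals (tagFrom p φ)) : p <:+ l.atom.2 := by
  induction φ generalizing p with
  | tt | ff => exact h.elim
  | lit l =>
    obtain rfl := h
    rw [Literal.atom_map]
  | next φ ih => exact ih h
  | and φ ψ ihφ ihψ | or φ ψ ihφ ihψ | untl φ ψ ihφ ihψ | release φ ψ ihφ ihψ =>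
    obtain h | h := h
    · exact (List.suffix_cons _ _).trans (ihφ h)
    · exact (List.suffix_cons _ _).trans (ihψ h)

theorem disjoint_literals_tagFrom (p : List Bool) (φ ψ : LTL A) :
    Disjoint (literals (tagFrom (false :: p) φ)) (literals (tagFrom (true :: p) ψ)) := by
  rw [Set.disjoint_left]
  intro l h₁ h₂
  have h := List.suffix_of_suffix_length_le (isSuffix_of_mem_literals_tagFrom h₁)
    (isSuffix_of_mem_literals_tagFrom h₂) (by simp)
  simpa using h.eq_of_length (by simp)

theorem linear_tagFrom (p : List Bool) (φ : LTL A) : Linear (tagFrom p φ) := by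
  induction φ generalizing p with
  | tt | ff | lit => trivial
  | next φ ih => exact ih p
  | and φ ψ ihφ ihψ | or φ ψ ihφ ihψ | untl φ ψ ihφ ihψ | release φ ψ ihφ ihψ =>
    exact ⟨ihφ _, ihψ _, disjoint_literals_tagFrom p φ ψ⟩

end Tag

end LTL

/-! ### Closed walks and infinite runs in a component -/

namespace TransitionSystem

variable {A S : Type*} {T : TransitionSystem A S}

/-- A finite walk, given by the list of its states, except the last one, with the labels of the
transitions leaving them. -/
inductive Walk (T : TransitionSystem A S) : S → List (S × Set (Literal A)) → S → Prop
  | nil (s) : Walk T s [] s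
  | cons {s α t l u} : T.Tran s α t → Walk T t l u → Walk T s ((s, α) :: l) u

theorem Walk.append {s t u : S} {l m : List (S × Set (Literal A))} (h : T.Walk s l t)
    (h' : T.Walk t m u) : T.Walk s (l ++ m) u := by
  induction h with
  | nil => exact h'
  | cons ht _ ih => exact .cons ht (ih h')

theorem Path.exists_walk {s t : S} (h : T.Path s t) : ∃ l, T.Walk s l t := by
  induction h using Relation.ReflTransGen.head_induction_on with
  | refl => exact ⟨[], .nil _⟩
  | head h _ ih =>
    obtain ⟨α, h⟩ := h
    obtain ⟨l, hl⟩ := ih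
    exact ⟨_, .cons h hl⟩

theorem Walk.tran {s t : S} {l : List (S × Set (Literal A))} (h : T.Walk s l t) (i : ℕ)
    (hi : i < l.length) :
    T.Tran l[i].1 l[i].2 (if h' : i + 1 < l.length then l[i + 1].1 else t) := by
  induction h generalizing i with
  | nil => simp at hi
  | @cons s α t l u ht hw ih =>
    cases i with
    | zero => cases hw <;> simpa using ht
    | succ i => simpa using ih i (by simpa using hi)

theorem Walk.head {s t : S} {l : List (S × Set (Literal A))} (h : T.Walk s l t)
    (hl : 0 < l.length) : l[0].1 = s := by
  cases h <;> simp at hl ⊢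

theorem sccLiterals_finite_walk {scc : Set S} {s : S} (hs : scc = {t | T.Path s t ∧ T.Path t s})
    {x : S} (hx : x ∈ scc) {F : Set (Literal A)} (hF : F.Finite) (hFL : F ⊆ T.sccLiterals scc) :
    ∃ l, T.Walk x l x ∧ ∀ a ∈ F, ∃ p ∈ l, a ∈ p.2 := by
  induction F, hF using Set.Finite.induction_on with
  | empty => exact ⟨[], .nil _, by simp⟩
  | @insert a F _ _ ih =>
    obtain ⟨l, hl, hl'⟩ := ih fun b hb => hFL (.inr hb)
    obtain ⟨u, hu, v, hv, α, ht, ha⟩ := hFL (.inl rfl)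
    subst hs
    obtain ⟨m, hm⟩ := Path.exists_walk (T := T) (hx.2.trans hu.1)
    obtain ⟨n, hn⟩ := Path.exists_walk (T := T) (hv.2.trans hx.1)
    -- The closed walk is prolonged by a detour from `x` through a transition carrying `a` and back.
    refine ⟨l ++ (m ++ ((u, α) :: n)), hl.append (hm.append (.cons ht hn)), ?_⟩
    rintro b (rfl | hb)
    · exact ⟨(u, α), by simp, ha⟩
    · obtain ⟨p, hp, hb⟩ := hl' b hb
      exact ⟨p, by simp [hp], hb⟩

/-- From a state of a strongly connected component with finitely many literals, and at least one,
there is an infinite run that returns to the state and uses every literal infinitely often. -/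
theorem exists_run {scc : Set S} {s : S} (hs : scc = {t | T.Path s t ∧ T.Path t s}) {x : S}
    (hx : x ∈ scc) (hfin : (T.sccLiterals scc).Finite) (hne : (T.sccLiterals scc).Nonempty) :
    ∃ (σ : ℕ → S) (α : ℕ → Set (Literal A)), σ 0 = x ∧ (∀ j, T.Tran (σ j) (α j) (σ (j + 1))) ∧
      (∃ᶠ j in Filter.atTop, σ j = x) ∧
      ∀ a ∈ T.sccLiterals scc, ∃ᶠ j in Filter.atTop, a ∈ α j := by
  obtain ⟨l, hl, hl'⟩ := sccLiterals_finite_walk hs hx hfin subset_rfl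
  obtain ⟨a, ha⟩ := hne
  obtain ⟨p, hp, -⟩ := hl' a ha
  -- Some literal has to be met, so the walk is not empty and can be repeated.
  have hpos : 0 < l.length := List.length_pos_of_mem hp
  have hmod : ∀ j, j % l.length < l.length := fun j => Nat.mod_lt _ hpos
  have hadd : ∀ N i, N * l.length + i ≥ N := fun N i =>
    (Nat.le_mul_of_pos_right N hpos).trans (Nat.le_add_right _ _)
  refine ⟨fun j => (l[j % l.length]'(hmod j)).1, fun j => (l[j % l.length]'(hmod j)).2,
    ?_, fun j => ?_, ?_, fun b hb => ?_⟩
  · simpa using hl.head hpos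
  · have := hl.tran (j % l.length) (hmod j)
    split_ifs at this with h
    · have he : (j + 1) % l.length = j % l.length + 1 := by
        rw [← Nat.mod_add_mod, Nat.mod_eq_of_lt h]
      simpa only [he] using this
    · have he : (j + 1) % l.length = 0 := by
        have : j % l.length + 1 = l.length := by have := hmod j; omega
        rw [← Nat.mod_add_mod, this, Nat.mod_self]
      simpa only [he, hl.head hpos] using this
  · rw [Filter.frequently_atTop]
    refine fun N => ⟨N * l.length + 0, hadd N 0, ?_⟩
    simpa using hl.head hpos
  · obtain ⟨p, hp, hb⟩ := hl' b hb
    obtain ⟨i, hi, rfl⟩ := List.getElem_of_mem hp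
    rw [Filter.frequently_atTop]
    refine fun N => ⟨N * l.length + i, hadd N i, ?_⟩
    have he : (N * l.length + i) % l.length = i := by
      rw [Nat.mul_add_mod_self_right, Nat.mod_eq_of_lt hi]
    simpa only [he] using hb

theorem path_of_run {σ : ℕ → S} {α : ℕ → Set (Literal A)}
    (h : ∀ j, T.Tran (σ j) (α j) (σ (j + 1))) {i j : ℕ} (hij : i ≤ j) : T.Path (σ i) (σ j) := by
  induction j, hij using Nat.le_induction with
  | base => exact .refl
  | succ j _ ih => exact ih.tail ⟨_, h j⟩

/-- A run in a finite set of states stays in one strongly connected component from some position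
on. -/
theorem exists_scc_of_run {σ : ℕ → S} {α : ℕ → Set (Literal A)} (h0 : σ 0 = T.init)
    (h : ∀ j, T.Tran (σ j) (α j) (σ (j + 1))) {F : Set S} (hF : F.Finite) (hσ : ∀ j, σ j ∈ F) :
    ∃ scc, T.IsSCC scc ∧ ∃ N, ∀ j ≥ N, σ j ∈ scc := by
  have : Finite F := hF
  -- Some state `x` recurs forever; all states after its first chosen visit lie between two visits.
  obtain ⟨x, hx⟩ := Finite.exists_infinite_fiber fun j => (⟨σ j, hσ j⟩ : F)
  have hinf := Set.infinite_coe_iff.1 hx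
  obtain ⟨N, hN⟩ := hinf.nonempty
  have hN : σ N = x := congrArg Subtype.val hN
  refine ⟨{t | T.Path (σ N) t ∧ T.Path t (σ N)}, ⟨σ N, ?_, rfl⟩, N, fun j hj => ?_⟩
  · rw [← h0]
    exact path_of_run h (Nat.zero_le N)
  · obtain ⟨k, hk, hjk⟩ := hinf.exists_gt j
    have hk : σ k = x := congrArg Subtype.val hk
    refine ⟨path_of_run h hj, ?_⟩
    rw [hN, ← hk]
    exact path_of_run h hjk.le

end TransitionSystem

/-! ### The two directions for the LTL transition system -/

open LTL

section LTLTransitionSystem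

variable {A I : Type*} {φ : LTL (A × I)}

theorem subset_of_mem_conjNormalForm {B : Type*} {φ : LTL B} {Ψ Ψ' : Set (LTL B)}
    {α : Set (Literal B)} (h : (α, Ψ') ∈ conjNormalForm Ψ) (hΨ : Ψ ⊆ subformulas φ) :
    α ⊆ literals φ ∧ Ψ' ⊆ subformulas φ := by
  obtain ⟨f, hf, he⟩ := h
  rw [Prod.mk.injEq] at he
  rw [he.1, he.2]
  refine ⟨Set.iUnion₂_subset fun ψ hψ => ?_, Set.iUnion₂_subset fun ψ hψ => ?_⟩
  · exact (normalForm_subset (hf ψ hψ)).1.trans (literals_subset_of_subformulas (hΨ hψ))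
  · exact fun θ hθ => subformulas_trans ((normalForm_subset (hf ψ hψ)).2 hθ) (hΨ hψ)

theorem subset_subformulas_of_path {Ψ Ψ' : Set (LTL (A × I))}
    (h : (ltlTransitionSystem φ).Path Ψ Ψ') (hΨ : Ψ ⊆ subformulas φ) : Ψ' ⊆ subformulas φ := by
  induction h with
  | refl => exact hΨ
  | tail _ h ih =>
    obtain ⟨α, h⟩ := h
    exact (subset_of_mem_conjNormalForm h.1 ih).2

/-- A trace satisfying the conjunction reached by a path extends backwards along the path. -/
theorem exists_sat_of_path {Ψ Ψ' : Set (LTL (A × I))} (h : (ltlTransitionSystem φ).Path Ψ Ψ')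
    (hs : ∃ ξ : ℕ → Set (Literal (A × I)),
      (∀ j, Literal.Consistent (Literal.map Prod.fst '' ξ j)) ∧ ∀ ψ ∈ Ψ', Sat ξ ψ) :
    ∃ ξ : ℕ → Set (Literal (A × I)),
      (∀ j, Literal.Consistent (Literal.map Prod.fst '' ξ j)) ∧ ∀ ψ ∈ Ψ, Sat ξ ψ := by
  induction h using Relation.ReflTransGen.head_induction_on with
  | refl => exact hs
  | head h _ ih =>
    obtain ⟨α, ⟨f, hf, he⟩, hα⟩ := h
    obtain ⟨ξ, hξ, ih⟩ := ih
    rw [Prod.mk.injEq] at he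
    refine ⟨fun n => n.casesOn α ξ, fun j => by cases j; exacts [hα, hξ _], fun ψ hψ => ?_⟩
    refine sat_of_mem_normalForm (hf ψ hψ) ?_ fun θ hθ => ?_
    · change _ ⊆ α
      rw [he.1]; exact Set.subset_biUnion_of_mem (u := fun ψ => (f ψ).1) hψ
    · have hsuf : suffix (fun n => n.casesOn α ξ : ℕ → Set (Literal (A × I))) 1 = ξ := by
        funext n
        simp [suffix, Nat.add_comm 1]
      rw [hsuf]
      refine ih θ ?_
      rw [he.2]; exact Set.subset_biUnion_of_mem (u := fun ψ => (f ψ).2) hψ hθ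

theorem exists_sat_of_scc (hφ : Linear φ) {scc : Set (Set (LTL (A × I)))}
    (hscc : (ltlTransitionSystem φ).IsSCC scc) {Ψ : Set (LTL (A × I))} (hΨ : Ψ ∈ scc)
    (h : ∀ ψ ∈ Ψ, ψ.obligation.WeakSat ((ltlTransitionSystem φ).sccLiterals scc)) :
    ∃ ξ : ℕ → Set (Literal (A × I)),
      (∀ j, Literal.Consistent (Literal.map Prod.fst '' ξ j)) ∧ Sat ξ φ := by
  obtain ⟨s, hs, hscc⟩ := hscc
  have hreach : ∀ t ∈ scc, (ltlTransitionSystem φ).Path φ.conjuncts t := by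
    intro t ht
    rw [hscc] at ht
    exact hs.trans ht.1
  have hsub : ∀ t ∈ scc, t ⊆ subformulas φ := fun t ht =>
    subset_subformulas_of_path (hreach t ht) (conjuncts_subset_subformulas φ)
  suffices ∃ ξ : ℕ → Set (Literal (A × I)),
      (∀ j, Literal.Consistent (Literal.map Prod.fst '' ξ j)) ∧ ∀ ψ ∈ Ψ, Sat ξ ψ by
    obtain ⟨ξ, hξ, h⟩ := exists_sat_of_path (hreach Ψ hΨ) this
    exact ⟨ξ, hξ, sat_of_conjuncts h⟩
  -- Without literals the component may have no transition and hence no run, but then the formulas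
  -- of `Ψ` are valid.
  obtain he | hne := ((ltlTransitionSystem φ).sccLiterals scc).eq_empty_or_nonempty
  · refine ⟨fun _ => ∅, fun _ a ha => by simp at ha, fun ψ hψ => ?_⟩
    exact sat_of_weakSat_obligation (by simp [he]) (h ψ hψ) _
  · have hfin : ((ltlTransitionSystem φ).sccLiterals scc).Finite := by
      refine (finite_literals φ).subset ?_
      rintro l ⟨u, hu, v, hv, α, ht, hl⟩
      exact (subset_of_mem_conjNormalForm ht.1 (hsub u hu)).1 hl
    obtain ⟨σ, α, h0, htran, hfreq, hlit⟩ :=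
      TransitionSystem.exists_run hscc hΨ hfin hne
    refine ⟨α, fun j => (htran j).2, fun ψ hψ => ?_⟩
    have hrun : ∀ j, (α j, σ (j + 1)) ∈ conjNormalForm (σ j) := fun j => (htran j).1
    have hσ : ∀ j, σ j ⊆ subformulas φ := by
      intro j
      refine subset_subformulas_of_path (TransitionSystem.path_of_run htran (Nat.zero_le j)) ?_
      rw [h0]
      exact hsub Ψ hΨ
    have hψ0 : ψ ∈ σ 0 := by rwa [h0]
    have := (sat_of_realised_aux hrun hσ hφ hlit (hfreq.mono fun j hj => by rwa [hj])
      (hσ 0 hψ0)).1 0 (realised_of_mem hrun hψ0)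
    rwa [suffix_zero] at this

theorem exists_scc_of_sat {ξ : ℕ → Set (Literal (A × I))}
    (hξ : ∀ j, Literal.Consistent (Literal.map Prod.fst '' ξ j)) (h : Sat ξ φ) :
    ∃ scc, (ltlTransitionSystem φ).IsSCC scc ∧ ∃ Ψ ∈ scc, ∀ ψ ∈ Ψ,
      ψ.obligation.WeakSat ((ltlTransitionSystem φ).sccLiterals scc) := by
  let σ : ℕ → Set (LTL (A × I)) := fun j =>
    Nat.rec φ.conjuncts (fun j Ψ => ⋃ ψ ∈ Ψ, (pick (suffix ξ j) ψ).2) j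
  let α : ℕ → Set (Literal (A × I)) := fun j => ⋃ ψ ∈ σ j, (pick (suffix ξ j) ψ).1
  have hsucc : ∀ j, σ (j + 1) = ⋃ ψ ∈ σ j, (pick (suffix ξ j) ψ).2 := fun j => rfl
  have hsat : ∀ j, ∀ ψ ∈ σ j, Sat (suffix ξ j) ψ := by
    intro j
    induction j with
    | zero => rw [suffix_zero]; exact sat_conjuncts h
    | succ j ih =>
      intro θ hθ
      rw [hsucc, Set.mem_iUnion₂] at hθ
      obtain ⟨ψ, hψ, hθ⟩ := hθ
      rw [← suffix_suffix]
      exact (pick_spec (ih ψ hψ)).2.2 θ hθ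
  have htran : ∀ j, (ltlTransitionSystem φ).Tran (σ j) (α j) (σ (j + 1)) := by
    refine fun j => ⟨⟨pick (suffix ξ j), fun ψ hψ => (pick_spec (hsat j ψ hψ)).1, rfl⟩, ?_⟩
    refine (hξ j).subset (Set.image_mono (Set.iUnion₂_subset fun ψ hψ => ?_))
    exact (pick_spec (hsat j ψ hψ)).2.1
  obtain ⟨scc, hscc, N, hN⟩ := TransitionSystem.exists_scc_of_run (T := ltlTransitionSystem φ)
    rfl htran (finite_subformulas φ).finite_subsets fun j => subset_subformulas_of_path
      (TransitionSystem.path_of_run htran (Nat.zero_le j)) (conjuncts_subset_subformulas φ)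
  refine ⟨scc, hscc, σ N, hN N le_rfl, fun ψ hψ => ?_⟩
  have hpick : ∀ j, ∀ ψ ∈ σ j,
      (pick (suffix ξ j) ψ).1 ⊆ α j ∧ (pick (suffix ξ j) ψ).2 ⊆ σ (j + 1) := fun j ψ hψ =>
    ⟨Set.subset_biUnion_of_mem (u := fun ψ => (pick (suffix ξ j) ψ).1) hψ,
      Set.subset_biUnion_of_mem (u := fun ψ => (pick (suffix ξ j) ψ).2) hψ⟩
  exact weakSat_obligation_of_pick (L := (ltlTransitionSystem φ).sccLiterals scc) hpick
    -- From `N` on the run stays in the component, so its labels count towards `L(scc)`.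
    (fun j hj l hl => ⟨_, hN j hj, _, hN (j + 1) (by omega), _, htran j, hl⟩) le_rfl
    (hsat N ψ hψ) (hpick N ψ hψ).1 (hpick N ψ hψ).2

end LTLTransitionSystem

theorem theorem4 {AP : Type*} (φ : LTL AP) :
    φ.Satisfiable ↔
      ∃ scc : Set (Set (LTL (AP × List Bool))),
        (ltlTransitionSystem φ.tag).IsSCC scc ∧
        ∃ Ψ ∈ scc, ∀ ψ ∈ Ψ,
          ψ.obligation.WeakSat ((ltlTransitionSystem φ.tag).sccLiterals scc) := by
  constructor
  · rintro ⟨ξ, hξ, h⟩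
    refine exists_scc_of_sat (fun j => (hξ j).subset ?_) (sat_tagFrom h)
    rintro _ ⟨l, hl, rfl⟩
    exact hl
  · rintro ⟨scc, hscc, Ψ, hΨ, h⟩
    obtain ⟨ξ, hξ, h⟩ := exists_sat_of_scc (linear_tagFrom [] φ) hscc hΨ h
    exact ⟨_, hξ, sat_untag h⟩
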